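/- Here $\mathbb{N}=\{1,2,\dots\}$ and all graphs are finite and simple. For $h,d\in\mathbb{N}$ let $U_{h,d}$ be the closure of the complete $d$-ary tree of vertex-height $h$: the tree is the rooted tree in which every root-to-leaf path has exactly $h$ vertices and every non-leaf vertex has exactly $d$ children, and in its closure two distinct vertices are adjacent if and only if one of them lies on the path from the root to the other. An $H$-model in a graph $G$ is a collection $(T_x : x\in V(H))$ of pairwise vertex-disjoint subtrees of $G$ such that for each $xy\in E(H)$ some edge of $G$ joins $T_x$ and $T_y$. It is non-trivial if $|V(T_x)|\ge 2$ for each $x\in V(H)$. It is odd if there is a $2$-colouring of $\bigcup_{x} V(T_x)$ such that each $T_x$ is properly coloured and, for each $xy\in E(H)$, there is a monochromatic edge of $G$ joining $T_x$ and $T_y$. A (not necessarily proper) colouring of $G$ has clustering $m$ if every connected component of the subgraph induced by each colour class has at most $m$ vertices. **Lemma.** For all $d,h,w\in\mathbb{N}$, every graph $G$ with treewidth at most $w$ that does not contain a non-trivial odd $U_{h,d}$-model can be coloured with $3\cdot 2^{h-1}-2$ colours with clustering $dw+d-w$. -/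

import Mathlib

namespace OddMinor

/-! ### Tree-decompositions and treewidth -/

/-- A tree-decomposition of `G`: bags indexed by the nodes of a (finite) tree. -/
structure TreeDecomposition {V : Type*} (G : SimpleGraph V) where
  /-- the nodes of the indexing tree -/
  Node : Type
  [fintypeNode : Fintype Node]
  /-- the indexing tree -/
  tree : SimpleGraph Node
  isTree : tree.IsTree
  /-- the bags -/
  bag : Node → Finset V
  /-- the two ends of every edge lie in a common bag -/
  edge_mem : ∀ v w : V, G.Adj v w → ∃ x, v ∈ bag x ∧ w ∈ bag x
  /-- the nodes whose bag contains `v` induce a non-empty subtree -/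
  connected : ∀ v : V, (tree.induce {x | v ∈ bag x}).Connected

attribute [instance] TreeDecomposition.fintypeNode

/-- The width: maximum bag size minus one. It is an integer because the width is `-1` if all
bags are empty. -/
def TreeDecomposition.width {V : Type*} {G : SimpleGraph V} (D : TreeDecomposition G) : ℤ :=
  ((Finset.univ.sup fun x => (D.bag x).card : ℕ) : ℤ) - 1

/-- The treewidth of a finite graph: the minimum width of a tree-decomposition. -/
noncomputable def treewidth {V : Type*} (G : SimpleGraph V) : ℤ :=
  sInf (Set.range fun D : TreeDecomposition G => D.width)

/-- The decomposition with a single bag. -/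
def TreeDecomposition.trivial {V : Type*} [Fintype V] (G : SimpleGraph V) :
    TreeDecomposition G where
  Node := Unit
  tree := ⊥
  isTree := SimpleGraph.IsTree.of_subsingleton
  bag := fun _ => Finset.univ
  edge_mem := fun v w _ => ⟨(), Finset.mem_univ v, Finset.mem_univ w⟩
  connected := fun v => by
    have : Nonempty {x : Unit | v ∈ (Finset.univ : Finset V)} := ⟨⟨(), Finset.mem_univ v⟩⟩
    exact SimpleGraph.Connected.mk SimpleGraph.Preconnected.of_subsingleton

/-- The infimum in the definition of the treewidth is a minimum. -/
theorem exists_width_eq_treewidth {V : Type*} [Fintype V] (G : SimpleGraph V) :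
    ∃ D : TreeDecomposition G, D.width = treewidth G := by
  have h : sInf (Set.range fun D : TreeDecomposition G => D.width) ∈
      Set.range fun D : TreeDecomposition G => D.width := by
    refine Int.csInf_mem ⟨_, ⟨TreeDecomposition.trivial G, rfl⟩⟩ ⟨-1, ?_⟩
    rintro _ ⟨D, rfl⟩
    simp only [TreeDecomposition.width]
    omega
  exact h

/-! ### Models -/

/-- An `H`-model in `G`: pairwise vertex-disjoint subtrees `T x` of `G`, one for each vertex `x`
of `H`, such that for every edge `xy` of `H` some edge of `G` joins `T x` and `T y`. -/
structure Model {W V : Type*} (H : SimpleGraph W) (G : SimpleGraph V) where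
  /-- the branch trees -/
  T : W → G.Subgraph
  isTree : ∀ x, (T x).coe.IsTree
  disjoint : ∀ x y, x ≠ y → Disjoint (T x).verts (T y).verts
  exists_adj : ∀ x y, H.Adj x y → ∃ u ∈ (T x).verts, ∃ v ∈ (T y).verts, G.Adj u v

namespace Model

variable {W V : Type*} {H : SimpleGraph W} {G : SimpleGraph V}

/-- The subgraph of `G` that is the union of all `T x` together with all the edges of `G` that
join `T x` and `T y` for an edge `xy` of `H`. -/
def spanned (M : Model H G) : G.Subgraph where
  verts := {v | ∃ x, v ∈ (M.T x).verts}
  Adj u v := (∃ x, (M.T x).Adj u v) ∨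
    ∃ x y, H.Adj x y ∧ u ∈ (M.T x).verts ∧ v ∈ (M.T y).verts ∧ G.Adj u v
  adj_sub := by
    rintro u v (⟨x, h⟩ | ⟨x, y, _, _, _, h⟩)
    · exact (M.T x).adj_sub h
    · exact h
  edge_vert := by
    rintro u v (⟨x, h⟩ | ⟨x, y, _, h, _, _⟩)
    · exact ⟨x, (M.T x).edge_vert h⟩
    · exact ⟨x, h⟩
  symm := ⟨by
    rintro u v (⟨x, h⟩ | ⟨x, y, h, hu, hv, huv⟩)
    · exact Or.inl ⟨x, h.symm⟩
    · exact Or.inr ⟨y, x, h.symm, hv, hu, huv.symm⟩⟩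

/-- The model is odd: some 2-colouring of the spanned subgraph is proper on every branch tree and
has, for every edge `xy` of `H`, a monochromatic edge joining `T x` and `T y`. -/
def IsOdd (M : Model H G) : Prop :=
  ∃ c : M.spanned.verts → Bool,
    (∀ x, ∀ u v : M.spanned.verts, (M.T x).Adj u v → c u ≠ c v) ∧
    ∀ x y, H.Adj x y → ∃ u v : M.spanned.verts,
      (u : V) ∈ (M.T x).verts ∧ (v : V) ∈ (M.T y).verts ∧ M.spanned.Adj u v ∧ c u = c v

/-- The model is non-trivial: every branch tree has at least two vertices. -/
def IsNontrivial (M : Model H G) : Prop :=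
  ∀ x, (M.T x).verts.Nontrivial

end Model

/-! ### Closures of rooted trees -/

/-- In the tree `T` with root `r`, the vertex `u` is a descendant of `v`: `v` lies on the path
from `r` to `u`. -/
def IsDescendant {W : Type*} (T : SimpleGraph W) (r u v : W) : Prop :=
  ∃ p : T.Walk r u, p.IsPath ∧ v ∈ p.support

/-- The closure of the tree `T` with root `r`. -/
def closure {W : Type*} (T : SimpleGraph W) (r : W) : SimpleGraph W where
  Adj u v := u ≠ v ∧ (IsDescendant T r u v ∨ IsDescendant T r v u)
  symm := ⟨fun _ _ h => ⟨h.1.symm, h.2.symm⟩⟩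
  loopless := ⟨fun _ h => h.1 rfl⟩

/-- The vertices of the complete `d`-ary tree of vertex-height `h ≥ 1`: words of length at most
`h - 1` over an alphabet with `d` letters. -/
abbrev Word (h d : ℕ) : Type := {l : List (Fin d) // l.length ≤ h - 1}

/-- The complete `d`-ary tree of vertex-height `h ≥ 1`: the children of the word `l` are the words
`a :: l`, as long as their length is at most `h - 1`. -/
def completeTree (h d : ℕ) : SimpleGraph (Word h d) where
  Adj u v := (∃ a, v.1 = a :: u.1) ∨ ∃ a, u.1 = a :: v.1
  symm := ⟨fun _ _ h => h.symm⟩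
  loopless := ⟨fun u h => by
    rcases h with ⟨a, h⟩ | ⟨a, h⟩ <;> simpa using congrArg List.length h⟩

/-- The root of the complete `d`-ary tree: the empty word. -/
def root (h d : ℕ) : Word h d := ⟨[], Nat.zero_le _⟩

/-- `U h d` is the closure of the complete `d`-ary tree of vertex-height `h ≥ 1`. -/
def U (h d : ℕ) : SimpleGraph (Word h d) :=
  closure (completeTree h d) (root h d)

theorem mem_support_of_suffix {h d : ℕ} {w r : Word h d} (p : (completeTree h d).Walk w r)
    (hr : r = root h d) (u : Word h d) (hu : u.1 <:+ w.1) : u ∈ p.support := by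
  induction p with
  | nil =>
    subst hr
    have : u = root h d := Subtype.ext (List.suffix_nil.1 hu)
    simp [this]
  | @cons w w' r hw p ih =>
    by_cases he : u = w
    · simp [he]
    · rw [SimpleGraph.Walk.support_cons]
      refine List.mem_cons_of_mem _ (ih hr ?_)
      rcases hw with ⟨a, ha⟩ | ⟨a, ha⟩
      · rw [ha]
        exact hu.trans (List.suffix_cons _ _)
      · rw [ha] at hu
        rcases List.suffix_cons_iff.1 hu with h1 | h1
        · exact absurd (Subtype.ext (h1.trans ha.symm)) he
        · exact h1

theorem suffix_of_mem_support {h d : ℕ} {w r : Word h d} (p : (completeTree h d).Walk w r)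
    (hr : r = root h d) (hp : p.IsPath) (u : Word h d) (hu : u ∈ p.support) : u.1 <:+ w.1 := by
  induction p with
  | nil => simp at hu; simp [hu]
  | @cons w w' r hw p ih =>
    rw [SimpleGraph.Walk.cons_isPath_iff] at hp
    rw [SimpleGraph.Walk.support_cons, List.mem_cons] at hu
    rcases hu with rfl | hu
    · exact List.suffix_refl _
    · rcases hw with ⟨a, ha⟩ | ⟨a, ha⟩
      · exact absurd (mem_support_of_suffix p hr w (ha ▸ List.suffix_cons _ _)) hp.2
      · rw [ha]
        exact (ih hr hp.1 hu).trans (List.suffix_cons _ _)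

theorem reachable_root {h d : ℕ} (l : List (Fin d)) (hl : l.length ≤ h - 1) :
    (completeTree h d).Reachable ⟨l, hl⟩ (root h d) := by
  induction l with
  | nil => exact SimpleGraph.Reachable.refl _
  | cons a l ih =>
    have h1 : l.length ≤ h - 1 := by simp at hl; omega
    have h2 : (completeTree h d).Adj ⟨a :: l, hl⟩ ⟨l, h1⟩ := Or.inr ⟨a, rfl⟩
    exact h2.reachable.trans (ih h1)

/-- In the complete `d`-ary tree, the descendants of `v` are the words that extend `v`. -/
theorem isDescendant_completeTree_iff {h d : ℕ} (u v : Word h d) :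
    IsDescendant (completeTree h d) (root h d) u v ↔ v.1 <:+ u.1 := by
  classical
  constructor
  · rintro ⟨p, hp, hv⟩
    exact suffix_of_mem_support p.reverse rfl hp.reverse v (by simpa using hv)
  · intro hv
    obtain ⟨p, hp⟩ := (reachable_root u.1 u.2).exists_isPath
    exact ⟨p.reverse, hp.reverse, by simpa using mem_support_of_suffix p rfl v hv⟩

/-- Adjacency in `U h d`, written out. -/
theorem U_adj {h d : ℕ} (u v : Word h d) :
    (U h d).Adj u v ↔ u ≠ v ∧ (v.1 <:+ u.1 ∨ u.1 <:+ v.1) := by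
  simp [U, closure, isDescendant_completeTree_iff]

/-! ### Clustered colourings -/

/-- The colouring `c` of the finite graph `G` has clustering `m`: every monochromatic component,
that is, every component of the subgraph induced by a colour class, has at most `m` vertices. -/
def HasClustering {V α : Type*} (G : SimpleGraph V) (c : V → α) (m : ℕ) : Prop :=
  ∀ (i : α) (C : (G.induce {v | c v = i}).ConnectedComponent), C.supp.ncard ≤ m

end OddMinor

namespace OddMinor

/-! Write d = k + 1 and b = w + 1. Induct on the height, for arbitrary vertex sets S. At height 1 a
single edge is already a non-trivial odd model, so S has no edges and one colour suffices. For the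
step one may assume that S is connected; take the breadth-first layers of S from a vertex r.

Fix a layer i ≥ 2. The union of the earlier layers, coloured by the parity of the depth, is
connected through bichromatic edges, and every vertex of layer i has a neighbour of a fixed colour β
in it. If layer i contained d disjoint models of the smaller height, this union could serve as a new
root branch set: a non-trivial properly coloured branch tree contains both colours, so it has a
vertex of colour β and hence a monochromatic edge to the root set (`HasOddModel.join`). So layer i
has at most k disjoint smaller models. These models are connected, so the Erdős–Pósa property of
connected sets under a tree-decomposition (`exists_disjoint_or_cover`) gives at most k * b vertices
that meet all of them. Layers 0 and 1 cost at most one more vertex (`exists_cover_layer`).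

Deleting these vertices leaves a layer to which induction applies. The deleted vertices receive one
new colour and form clusters of at most k * b + 1 vertices; two palettes alternate between the
layers. The number of colours thus satisfies N(n + 1) = 2 (N(n) + 1) with N(0) = 1, that is N(n) = 3
* 2 ^ n - 2. -/

variable {V : Type*}

/-! ### Connected vertex sets -/

/-- The set `A` induces a preconnected subgraph of `G`, expressed through cuts. -/
def IsPreconnectedOn (G : SimpleGraph V) (A : Set V) : Prop :=
  ∀ Z : Set V, (∃ a ∈ A, a ∈ Z) → (∀ u ∈ A, u ∈ Z → ∀ v ∈ A, G.Adj u v → v ∈ Z) → A ⊆ Z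

/-- The cut form acts as an induction principle: a property that holds at one point of `A` and
passes along the edges inside `A` holds on all of `A`. Most connectivity arguments below use it in
place of walks in subtypes. -/
theorem isPreconnectedOn_iff (G : SimpleGraph V) (A : Set V) :
    IsPreconnectedOn G A ↔ (G.induce A).Preconnected := by
  constructor
  · rintro h ⟨a, ha⟩ ⟨b, hb⟩
    have := h {v | ∃ hv : v ∈ A, (G.induce A).Reachable ⟨a, ha⟩ ⟨v, hv⟩}
      ⟨a, ha, ha, SimpleGraph.Reachable.refl _⟩ (by
        rintro u hu ⟨_, hr⟩ v hv huv
        refine ⟨hv, hr.trans (SimpleGraph.Adj.reachable ?_)⟩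
        simpa using huv)
    exact (this hb).2
  · rintro h Z ⟨a, ha, haZ⟩ hZ b hb
    obtain ⟨p⟩ := h ⟨a, ha⟩ ⟨b, hb⟩
    have key : ∀ (x y : A), (G.induce A).Walk x y → (x : V) ∈ Z → (y : V) ∈ Z := by
      intro x y p
      induction p with
      | nil => exact id
      | @cons x x' y hxx' _ ih =>
        exact fun hx => ih (hZ x x.2 hx x' x'.2 (by simpa using hxx'))
    exact key _ _ p haZ

theorem isPreconnectedOn_supp {G : SimpleGraph V} {S : Set V}
    (C : (G.induce S).ConnectedComponent) : IsPreconnectedOn G (Subtype.val '' C.supp) := by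
  rintro Z ⟨_, ⟨a, ha, rfl⟩, haZ⟩ hZ _ ⟨b, hb, rfl⟩
  have hab : (G.induce S).Reachable a b := by
    rw [SimpleGraph.ConnectedComponent.mem_supp_iff] at ha hb
    exact SimpleGraph.ConnectedComponent.exact (ha.trans hb.symm)
  obtain ⟨p⟩ := hab
  clear hb
  induction p with
  | nil => exact haZ
  | @cons a a' b haa' _ ih =>
    have ha' : a' ∈ C.supp := by
      rw [SimpleGraph.ConnectedComponent.mem_supp_iff] at ha ⊢
      rw [← ha]
      exact (SimpleGraph.ConnectedComponent.sound haa'.reachable).symm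
    exact ih ha' (hZ a ⟨a, ha, rfl⟩ haZ a' ⟨a', ha', rfl⟩ (by simpa using haa'))

theorem IsPreconnectedOn.mono {G H : SimpleGraph V} {A : Set V} (hGH : G ≤ H)
    (h : IsPreconnectedOn G A) : IsPreconnectedOn H A :=
  fun Z hne hZ => h Z hne fun u hu huZ v hv huv => hZ u hu huZ v hv (hGH huv)

/-- A set all of whose points are joined to a fixed point inside preconnected subsets is
preconnected. -/
theorem IsPreconnectedOn.of_star {G : SimpleGraph V} {A : Set V} (r : V)
    (h : ∀ v ∈ A, ∃ C ⊆ A, r ∈ C ∧ v ∈ C ∧ IsPreconnectedOn G C) : IsPreconnectedOn G A := by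
  rintro Z ⟨a, ha, haZ⟩ hZ b hb
  have hr : r ∈ Z := by
    obtain ⟨C, hCA, hrC, haC, hC⟩ := h a ha
    exact hC Z ⟨a, haC, haZ⟩ (fun u hu huZ v hv => hZ u (hCA hu) huZ v (hCA hv)) hrC
  obtain ⟨C, hCA, hrC, hbC, hC⟩ := h b hb
  exact hC Z ⟨r, hrC, hr⟩ (fun u hu huZ v hv => hZ u (hCA hu) huZ v (hCA hv)) hbC

theorem IsPreconnectedOn.union {G : SimpleGraph V} {A B : Set V} (hA : IsPreconnectedOn G A)
    (hB : IsPreconnectedOn G B) {u v : V} (hu : u ∈ A) (hv : v ∈ B) (huv : G.Adj u v) :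
    IsPreconnectedOn G (A ∪ B) := by
  rintro Z ⟨a, ha, haZ⟩ hZ
  have hA' : (∃ a ∈ A, a ∈ Z) → A ⊆ Z := fun h =>
    hA Z h fun x hx hxZ y hy => hZ x (Or.inl hx) hxZ y (Or.inl hy)
  have hB' : (∃ a ∈ B, a ∈ Z) → B ⊆ Z := fun h =>
    hB Z h fun x hx hxZ y hy => hZ x (Or.inr hx) hxZ y (Or.inr hy)
  rcases ha with ha | ha
  · have h1 := hA' ⟨a, ha, haZ⟩
    exact Set.union_subset h1
      (hB' ⟨v, hv, hZ u (Or.inl hu) (h1 hu) v (Or.inr hv) huv⟩)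
  · have h1 := hB' ⟨a, ha, haZ⟩
    exact Set.union_subset
      (hA' ⟨u, hu, hZ v (Or.inr hv) (h1 hv) u (Or.inl hu) huv.symm⟩) h1

/-! ### Packing and covering connected sets in a tree-decomposition -/

/-- The nodes that `t` separates from `ρ`, including `t`. -/
def below {N : Type*} (T : SimpleGraph N) (ρ t : N) : Set N :=
  {y | ∀ p : T.Walk y ρ, t ∈ p.support}

theorem below_of_adj {N : Type*} {T : SimpleGraph N} {ρ t y z : N} (hy : y ∈ below T ρ t)
    (hyt : y ≠ t) (hyz : T.Adj y z) : z ∈ below T ρ t := by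
  intro p
  have := hy (SimpleGraph.Walk.cons hyz p)
  rw [SimpleGraph.Walk.support_cons, List.mem_cons] at this
  exact this.resolve_left fun h => hyt h.symm

theorem self_mem_below {N : Type*} (T : SimpleGraph N) (ρ t : N) : t ∈ below T ρ t :=
  fun p => p.start_mem_support

theorem dist_lt_of_mem_below {N : Type*} {T : SimpleGraph N} (hT : T.Connected) {ρ t y : N}
    (hy : y ∈ below T ρ t) (hyt : y ≠ t) : T.dist t ρ < T.dist y ρ := by
  classical
  obtain ⟨p, hp⟩ := hT.exists_walk_length_eq_dist y ρ
  have ht := hy p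
  have h1 := congrArg SimpleGraph.Walk.length (p.take_spec ht)
  rw [SimpleGraph.Walk.length_append] at h1
  have h2 : 0 < (p.takeUntil t ht).length := by
    rcases Nat.eq_zero_or_pos (p.takeUntil t ht).length with h | h
    · exact absurd (SimpleGraph.Walk.eq_of_length_eq_zero h) hyt
    · exact h
  have h3 := SimpleGraph.dist_le (p.dropUntil t ht)
  omega

/-- The distance condition makes a shortest path from `t` to `ρ` avoid `y`. Prefixing it with `y`
gives the unique path from `y` to `ρ` in the tree, which every walk from `y` to `ρ` must contain. -/
theorem mem_below_of_adj_top {N : Type*} {T : SimpleGraph N} (hT : T.IsTree) {ρ t y : N}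
    (hty : T.Adj t y) (hd : T.dist t ρ ≤ T.dist y ρ) : y ∈ below T ρ t := by
  classical
  obtain ⟨p, hp, hl⟩ := hT.connected.exists_path_of_dist t ρ
  have hyp : y ∉ p.support := by
    intro h
    have h1 := congrArg SimpleGraph.Walk.length (p.take_spec h)
    rw [SimpleGraph.Walk.length_append] at h1
    have h2 : 0 < (p.takeUntil y h).length := by
      rcases Nat.eq_zero_or_pos (p.takeUntil y h).length with h | h
      · exact absurd (SimpleGraph.Walk.eq_of_length_eq_zero h) hty.ne
      · exact h
    have h3 := SimpleGraph.dist_le (p.dropUntil y h)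
    omega
  have hq : (SimpleGraph.Walk.cons hty.symm p).IsPath := by
    rw [SimpleGraph.Walk.cons_isPath_iff]
    exact ⟨hp, hyp⟩
  intro q
  have := (hT.isAcyclic.subsingleton_path y ρ).elim ⟨_, hq⟩ q.toPath
  apply SimpleGraph.Walk.support_toPath_subset_support q
  rw [← this]
  simp

/-- Erdős–Pósa property. The nodes whose bags meet a connected set form a subtree. Take the member
`A` whose node `t` nearest to the root `ρ` is deepest. Every member disjoint from the bag of `t` is
then disjoint from `A`, so one round either adds `A` to the packing or adds one bag, of at most `b`
vertices, to the cover. -/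
theorem exists_disjoint_or_cover {G : SimpleGraph V} (D : TreeDecomposition G) (b : ℕ)
    (hD : ∀ x, (D.bag x).card ≤ b) (k : ℕ) (F : Set (Set V))
    (hF : ∀ A ∈ F, A.Nonempty ∧ IsPreconnectedOn G A) :
    (∃ A : Fin (k + 1) → Set V, (∀ i, A i ∈ F) ∧ ∀ i j, i ≠ j → Disjoint (A i) (A j)) ∨
    ∃ X : Finset V, X.card ≤ k * b ∧ ∀ A ∈ F, ∃ v ∈ A, v ∈ X := by
  classical
  have hconn : ∀ v, IsPreconnectedOn D.tree {x | v ∈ D.bag x} := fun v =>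
    (isPreconnectedOn_iff _ _).2 (D.connected v).preconnected
  have hbag : ∀ v, ∃ x, v ∈ D.bag x := fun v => by
    obtain ⟨x⟩ := (D.connected v).nonempty
    exact ⟨x.1, x.2⟩
  obtain ⟨ρ⟩ := D.isTree.connected.nonempty
  induction k generalizing F with
  | zero =>
    by_cases h : F.Nonempty
    · obtain ⟨A, hA⟩ := h
      exact Or.inl ⟨fun _ => A, fun _ => hA, fun i j hij => by omega⟩
    · refine Or.inr ⟨∅, by simp, fun A hA => absurd ⟨A, hA⟩ h⟩
  | succ k ih =>
    by_cases h : F.Nonempty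
    swap
    · exact Or.inr ⟨∅, by simp, fun A hA => absurd ⟨A, hA⟩ h⟩
    have htop : ∀ A : Set V, A.Nonempty → ∃ t, (∃ v ∈ A, v ∈ D.bag t) ∧
        ∀ s, (∃ v ∈ A, v ∈ D.bag s) → D.tree.dist t ρ ≤ D.tree.dist s ρ := by
      rintro A ⟨a, ha⟩
      obtain ⟨x, hx⟩ := hbag a
      obtain ⟨t, ht, hmin⟩ := Set.exists_min_image {s | ∃ v ∈ A, v ∈ D.bag s}
        (fun s => D.tree.dist s ρ) (Set.toFinite _) ⟨x, a, ha, hx⟩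
      exact ⟨t, ht, hmin⟩
    -- the node of maximal depth among the topmost nodes of the members of `F`
    obtain ⟨t, ⟨A, hAF, ⟨a₀, ha₀, ha₀t⟩, hAmin⟩, hmax⟩ := Set.exists_max_image
      {t | ∃ A ∈ F, (∃ v ∈ A, v ∈ D.bag t) ∧
        ∀ s, (∃ v ∈ A, v ∈ D.bag s) → D.tree.dist t ρ ≤ D.tree.dist s ρ}
      (fun s => D.tree.dist s ρ) (Set.toFinite _) (by
        obtain ⟨A, hA⟩ := h
        obtain ⟨t, h1, h2⟩ := htop A (hF A hA).1
        exact ⟨t, A, hA, h1, h2⟩)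
    -- The nodes below `t` can only be left through `t`, and the neighbours of `t` whose bags meet
    -- `A` are no nearer to the root, hence also below `t`.
    have hAbelow : ∀ v ∈ A, {x | v ∈ D.bag x} ⊆ below D.tree ρ t := by
      have stay : ∀ v ∈ A, (∃ x, v ∈ D.bag x ∧ x ∈ below D.tree ρ t) →
          {x | v ∈ D.bag x} ⊆ below D.tree ρ t := by
        rintro v hv ⟨x, hx, hxt⟩
        refine hconn v _ ⟨x, hx, hxt⟩ ?_
        intro y hy hyt z hz hyz
        by_cases hyt' : y = t
        · subst hyt'
          exact mem_below_of_adj_top D.isTree hyz (hAmin z ⟨v, hv, hz⟩)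
        · exact below_of_adj hyt hyt' hyz
      refine (hF A hAF).2 {v | {x | v ∈ D.bag x} ⊆ below D.tree ρ t}
        ⟨a₀, ha₀, stay a₀ ha₀ ⟨t, ha₀t, self_mem_below _ _ _⟩⟩ ?_
      intro u hu huZ v hv huv
      obtain ⟨x, hux, hvx⟩ := D.edge_mem u v huv
      exact stay v hv ⟨x, hvx, huZ hux⟩
    have hdisj : ∀ A' ∈ F, (∀ v ∈ A', v ∉ D.bag t) → Disjoint A A' := by
      intro A' hA' hmiss
      -- A common vertex would put some node of `A'` below `t`. As `A'` misses the bag of `t`, all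
      -- its nodes would lie strictly below `t`, so its topmost node would be deeper than `t`,
      -- against the choice of `A`.
      rw [Set.disjoint_left]
      intro v hvA hvA'
      have stay : ∀ u ∈ A', (∃ x, u ∈ D.bag x ∧ x ∈ below D.tree ρ t) →
          {x | u ∈ D.bag x} ⊆ below D.tree ρ t := by
        rintro u hu ⟨x, hx, hxt⟩
        refine hconn u _ ⟨x, hx, hxt⟩ ?_
        intro y hy hyt z hz hyz
        refine below_of_adj hyt ?_ hyz
        rintro rfl
        exact hmiss u hu hy
      have hall : A' ⊆ {u | {x | u ∈ D.bag x} ⊆ below D.tree ρ t} := by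
        refine (hF A' hA').2 _ ⟨v, hvA', hAbelow v hvA⟩ ?_
        intro u hu huZ u' hu' huu'
        obtain ⟨x, hux, hvx⟩ := D.edge_mem u u' huu'
        exact stay u' hu' ⟨x, hvx, huZ hux⟩
      obtain ⟨t', ⟨a', ha', hat'⟩, hmin'⟩ := htop A' (hF A' hA').1
      have h1 := hmax t' ⟨A', hA', ⟨a', ha', hat'⟩, hmin'⟩
      have h2 : t' ≠ t := by
        rintro rfl
        exact hmiss a' ha' hat'
      have h3 := dist_lt_of_mem_below D.isTree.connected (hall ha' hat') h2
      exact absurd h1 (not_le.2 h3)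
    rcases ih {A' ∈ F | ∀ v ∈ A', v ∉ D.bag t} (fun A' hA' => hF A' hA'.1) with
      ⟨B, hBF, hB⟩ | ⟨X, hX, hcov⟩
    · refine Or.inl ⟨Fin.cons A B, ?_, ?_⟩
      · intro i
        refine Fin.cases ?_ (fun i => ?_) i
        · exact hAF
        · exact (hBF i).1
      · intro i j
        refine Fin.cases ?_ (fun i => ?_) i <;> refine Fin.cases ?_ (fun j => ?_) j
        · exact fun h => absurd rfl h
        · intro _
          exact hdisj _ (hBF j).1 (hBF j).2
        · intro _
          exact (hdisj _ (hBF i).1 (hBF i).2).symm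
        · intro hij
          exact hB i j fun h => hij (h ▸ rfl)
    · refine Or.inr ⟨D.bag t ∪ X, ?_, ?_⟩
      · have := Finset.card_union_le (D.bag t) X
        have := hD t
        rw [Nat.succ_mul]
        omega
      · intro A' hA'
        by_cases hm : ∀ v ∈ A', v ∉ D.bag t
        · obtain ⟨v, hv, hvX⟩ := hcov A' ⟨hA', hm⟩
          exact ⟨v, hv, Finset.mem_union_right _ hvX⟩
        · push Not at hm
          obtain ⟨v, hv, hvt⟩ := hm
          exact ⟨v, hv, Finset.mem_union_left _ hvt⟩

/-! ### Odd models of closures, in terms of vertex sets -/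

/-- The spanning subgraph of the edges of `G` with two colours. -/
def bichromatic (G : SimpleGraph V) (c : V → Bool) : SimpleGraph V where
  Adj u v := G.Adj u v ∧ c u ≠ c v
  symm := ⟨fun _ _ h => ⟨h.1.symm, h.2.symm⟩⟩
  loopless := ⟨fun _ h => h.2 rfl⟩

/-- The sets `B l`, for the words `l` of length at most `n`, are the vertex sets of the branch
trees of a non-trivial odd `U (n + 1) d`-model inside `S`, for the 2-colouring `c`. -/
structure IsOddModelOn (G : SimpleGraph V) (d n : ℕ) (S : Set V)
    (B : List (Fin d) → Set V) (c : V → Bool) : Prop where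
  subset : ∀ l, l.length ≤ n → B l ⊆ S
  nontrivial : ∀ l, l.length ≤ n → (B l).Nontrivial
  preconnected : ∀ l, l.length ≤ n → IsPreconnectedOn (bichromatic G c) (B l)
  disjoint : ∀ l l', l.length ≤ n → l'.length ≤ n → l ≠ l' → Disjoint (B l) (B l')
  adj : ∀ l l', l.length ≤ n → l'.length ≤ n → l ≠ l' → l <:+ l' →
    ∃ u ∈ B l, ∃ v ∈ B l', G.Adj u v ∧ c u = c v

/-- `G[S]` contains a non-trivial odd `U (n + 1) d`-model. -/
def HasOddModel (G : SimpleGraph V) (d n : ℕ) (S : Set V) : Prop :=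
  ∃ B c, IsOddModelOn G d n S B c

theorem HasOddModel.nonempty {G : SimpleGraph V} {d n : ℕ} {S : Set V}
    (h : HasOddModel G d n S) : S.Nonempty := by
  obtain ⟨B, c, h⟩ := h
  exact (h.nontrivial [] (Nat.zero_le _)).nonempty.mono (h.subset [] (Nat.zero_le _))

theorem HasOddModel.mono {G : SimpleGraph V} {d n : ℕ} {S S' : Set V} (hS : S ⊆ S')
    (h : HasOddModel G d n S) : HasOddModel G d n S' := by
  obtain ⟨B, c, h⟩ := h
  exact ⟨B, c, fun l hl => (h.subset l hl).trans hS, h.nontrivial, h.preconnected, h.disjoint,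
    h.adj⟩

/-- The vertex set of a model of the closure of a tree is connected. -/
theorem HasOddModel.exists_connected {G : SimpleGraph V} {d n : ℕ} {S : Set V}
    (h : HasOddModel G d n S) :
    ∃ A ⊆ S, A.Nonempty ∧ IsPreconnectedOn G A ∧ HasOddModel G d n A := by
  obtain ⟨B, c, h⟩ := h
  have h0 : ([] : List (Fin d)).length ≤ n := Nat.zero_le _
  have hle : bichromatic G c ≤ G := fun _ _ h => h.1
  have hmodel : HasOddModel G d n {v | ∃ l, l.length ≤ n ∧ v ∈ B l} :=
    ⟨B, c, fun l hl v hv => ⟨l, hl, hv⟩, h.nontrivial, h.preconnected, h.disjoint, h.adj⟩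
  refine ⟨_, ?_, hmodel.nonempty, ?_, hmodel⟩
  · rintro v ⟨l, hl, hv⟩
    exact h.subset l hl hv
  · obtain ⟨r, hr⟩ := (h.nontrivial [] h0).nonempty
    -- The root of the closure is adjacent to every other vertex, so each branch set is joined by an
    -- edge to the root branch set.
    apply IsPreconnectedOn.of_star r
    rintro v ⟨l, hl, hv⟩
    by_cases hl0 : [] = l
    · subst hl0
      exact ⟨B [], fun x hx => ⟨[], h0, hx⟩, hr, hv, (h.preconnected [] h0).mono hle⟩
    · obtain ⟨x, hx, y, hy, hxy, _⟩ := h.adj [] l h0 hl hl0 (List.nil_suffix)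
      refine ⟨B [] ∪ B l, ?_, Or.inl hr, Or.inr hv,
        ((h.preconnected [] h0).mono hle).union ((h.preconnected l hl).mono hle) hx hy hxy⟩
      exact Set.union_subset (fun x hx => ⟨[], h0, hx⟩) fun x hx => ⟨l, hl, hx⟩

/-- A bichromatically connected set with two vertices contains both colours. -/
theorem exists_mem_of_color {G : SimpleGraph V} {c : V → Bool} {A : Set V}
    (hA : A.Nontrivial) (hc : IsPreconnectedOn (bichromatic G c) A) (β : Bool) :
    ∃ v ∈ A, c v = β := by
  by_contra! hne
  obtain ⟨a, ha, b, hb, hab⟩ := hA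
  -- If the colour `β` is missing, all of `A` has the other colour, so no bichromatic edge lies
  -- inside `A`.
  have : A ⊆ {a} := by
    refine hc _ ⟨a, ha, rfl⟩ ?_
    rintro u hu - v hv huv
    have h1 := hne u hu
    have h2 := hne v hv
    have h3 := huv.2
    cases hu' : c u <;> cases hv' : c v <;> cases β <;> simp_all
  exact hab (this hb).symm

/-- The branch sets of the model obtained by joining `d` models to a root set `R`. -/
def joinBranch {d : ℕ} (R : Set V) (B : Fin d → List (Fin d) → Set V) (l : List (Fin d)) : Set V :=
  -- Words grow at the front, so the last letter tells which child of the root the word descends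
  -- from.
  match l.getLast? with
  | none => R
  | some j => B j l.dropLast

@[simp] theorem joinBranch_nil {d : ℕ} (R : Set V) (B : Fin d → List (Fin d) → Set V) :
    joinBranch R B [] = R := rfl

@[simp] theorem joinBranch_append {d : ℕ} (R : Set V) (B : Fin d → List (Fin d) → Set V)
    (l : List (Fin d)) (j : Fin d) : joinBranch R B (l ++ [j]) = B j l := by
  simp [joinBranch]

theorem IsPreconnectedOn.congr_color {G : SimpleGraph V} {c c' : V → Bool} {A : Set V}
    (h : IsPreconnectedOn (bichromatic G c) A) (hcc' : ∀ v ∈ A, c' v = c v) :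
    IsPreconnectedOn (bichromatic G c') A := by
  intro Z hne hZ
  refine h Z hne fun u hu huZ v hv huv => hZ u hu huZ v hv ⟨huv.1, ?_⟩
  rw [hcc' u hu, hcc' v hv]
  exact huv.2

/-- The colourings of `R` and of the sets `A j` are glued unchanged, as these sets are disjoint.
Every branch set inside `A j` has a vertex of colour `β`, whose neighbour in `R` of colour `β`
provides the monochromatic edge to the new root branch set. -/
theorem HasOddModel.join {G : SimpleGraph V} {d n : ℕ} {R S : Set V} {c₀ : V → Bool}
    (hR : R.Nontrivial) (hRc : IsPreconnectedOn (bichromatic G c₀) R) (hRS : R ⊆ S)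
    {A : Fin d → Set V} (hAS : ∀ j, A j ⊆ S) (hA : ∀ j, HasOddModel G d n (A j))
    (hdisj : ∀ i j, i ≠ j → Disjoint (A i) (A j)) (hRA : ∀ j, Disjoint R (A j)) (β : Bool)
    (hadj : ∀ j, ∀ v ∈ A j, ∃ u ∈ R, G.Adj u v ∧ c₀ u = β) : HasOddModel G d (n + 1) S := by
  classical
  choose B c hB using hA
  let c' : V → Bool := fun v => if h : ∃ j, v ∈ A j then c h.choose v else c₀ v
  have hc'A : ∀ j, ∀ v ∈ A j, c' v = c j v := by
    intro j v hv
    have h : ∃ j, v ∈ A j := ⟨j, hv⟩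
    have hj : h.choose = j := by
      by_contra hne
      exact Set.disjoint_left.1 (hdisj _ _ hne) h.choose_spec hv
    simp only [c', dif_pos h, hj]
  have hc'R : ∀ v ∈ R, c' v = c₀ v := by
    intro v hv
    have h : ¬ ∃ j, v ∈ A j := fun ⟨j, hj⟩ => Set.disjoint_left.1 (hRA j) hv hj
    simp only [c', dif_neg h]
  have hlen : ∀ (l : List (Fin d)) (j : Fin d), (l ++ [j]).length ≤ n + 1 → l.length ≤ n := by
    intro l j h
    simpa using h
  have hroot : ∀ (l : List (Fin d)) (j : Fin d), (l ++ [j]).length ≤ n + 1 →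
      ∃ u ∈ R, ∃ v ∈ B j l, G.Adj u v ∧ c' u = c' v := by
    intro l j h
    have hl := hlen l j h
    obtain ⟨v, hv, hvβ⟩ := exists_mem_of_color ((hB j).nontrivial l hl)
      ((hB j).preconnected l hl) β
    have hvA := (hB j).subset l hl hv
    obtain ⟨u, hu, huv, huβ⟩ := hadj j v hvA
    exact ⟨u, hu, v, hv, huv, by rw [hc'R u hu, hc'A j v hvA, huβ, hvβ]⟩
  refine ⟨joinBranch R B, c', ?_, ?_, ?_, ?_, ?_⟩
  · intro l hl
    rcases List.eq_nil_or_concat l with rfl | ⟨l, j, rfl⟩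
    · simpa using hRS
    · rw [List.concat_eq_append] at *
      rw [joinBranch_append]
      exact ((hB j).subset l (hlen l j hl)).trans (hAS j)
  · intro l hl
    rcases List.eq_nil_or_concat l with rfl | ⟨l, j, rfl⟩
    · simpa using hR
    · rw [List.concat_eq_append] at *
      rw [joinBranch_append]
      exact (hB j).nontrivial l (hlen l j hl)
  · intro l hl
    rcases List.eq_nil_or_concat l with rfl | ⟨l, j, rfl⟩
    · exact hRc.congr_color hc'R
    · rw [List.concat_eq_append] at *
      rw [joinBranch_append]
      exact ((hB j).preconnected l (hlen l j hl)).congr_color fun v hv =>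
        hc'A j v ((hB j).subset l (hlen l j hl) hv)
  · intro l l' hl hl' hne
    rcases List.eq_nil_or_concat l with rfl | ⟨l, j, rfl⟩ <;>
      rcases List.eq_nil_or_concat l' with rfl | ⟨l', j', rfl⟩
    · exact absurd rfl hne
    · rw [List.concat_eq_append] at *
      rw [joinBranch_append, joinBranch_nil]
      exact (hRA j').mono_right ((hB j').subset l' (hlen l' j' hl'))
    · rw [List.concat_eq_append] at *
      rw [joinBranch_append, joinBranch_nil]
      exact ((hRA j).mono_right ((hB j).subset l (hlen l j hl))).symm
    · rw [List.concat_eq_append] at *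
      rw [List.concat_eq_append] at *
      rw [joinBranch_append, joinBranch_append]
      by_cases hj : j = j'
      · subst hj
        exact (hB j).disjoint l l' (hlen l j hl) (hlen l' j hl') fun h => hne (h ▸ rfl)
      · exact (hdisj j j' hj).mono ((hB j).subset l (hlen l j hl))
          ((hB j').subset l' (hlen l' j' hl'))
  · intro l l' hl hl' hne hsuf
    rcases List.eq_nil_or_concat l with rfl | ⟨l, j, rfl⟩ <;>
      rcases List.eq_nil_or_concat l' with rfl | ⟨l', j', rfl⟩
    · exact absurd rfl hne
    · rw [List.concat_eq_append] at *
      rw [joinBranch_append, joinBranch_nil]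
      exact hroot l' j' hl'
    · simp at hsuf
    · rw [List.concat_eq_append] at *
      rw [List.concat_eq_append] at *
      -- A non-empty suffix shares its last letter with the whole word, so both words lie in the
      -- same submodel.
      obtain ⟨s, hs⟩ := hsuf
      rw [← List.append_assoc] at hs
      obtain ⟨hs1, hs2⟩ := List.append_inj' hs rfl
      obtain rfl : j = j' := by simpa using hs2
      obtain ⟨u, hu, v, hv, huv, huv'⟩ := (hB j).adj l l' (hlen l j hl) (hlen l' j hl')
        (fun h => hne (h ▸ rfl)) ⟨s, hs1⟩
      rw [joinBranch_append, joinBranch_append]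
      exact ⟨u, hu, v, hv, huv, by
        rw [hc'A j u ((hB j).subset l (hlen l j hl) hu),
          hc'A j v ((hB j).subset l' (hlen l' j hl') hv), huv']⟩

/-- The subgraph of `G` with vertex set `A` and the edges of a graph on `A`. -/
def subgraphOf {G : SimpleGraph V} {A : Set V} (t : SimpleGraph A) (ht : t ≤ G.induce A) :
    G.Subgraph where
  verts := A
  Adj u v := ∃ (hu : u ∈ A) (hv : v ∈ A), t.Adj ⟨u, hu⟩ ⟨v, hv⟩
  adj_sub := by
    rintro u v ⟨hu, hv, h⟩
    simpa using ht h
  edge_vert := fun ⟨hu, _, _⟩ => hu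
  symm := ⟨fun _ _ ⟨hu, hv, h⟩ => ⟨hv, hu, h.symm⟩⟩

theorem subgraphOf_coe {G : SimpleGraph V} {A : Set V} (t : SimpleGraph A)
    (ht : t ≤ G.induce A) : (subgraphOf t ht).coe = t := by
  ext u v
  exact ⟨fun ⟨_, _, h⟩ => h, fun h => ⟨u.2, v.2, h⟩⟩

/-- A spanning tree of the bichromatic graph on a branch set is properly coloured, so bichromatic
connectivity is all that has to be recorded about a branch tree. -/
theorem HasOddModel.exists_model {G : SimpleGraph V} {d h : ℕ}
    (hm : HasOddModel G d (h - 1) Set.univ) :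
    ∃ M : Model (U h d) G, M.IsNontrivial ∧ M.IsOdd := by
  obtain ⟨B, c, hB⟩ := hm
  have htree : ∀ x : Word h d, ∃ t : SimpleGraph (B x.1),
      t ≤ (bichromatic G c).induce (B x.1) ∧ t.IsTree := by
    intro x
    have hconn : ((bichromatic G c).induce (B x.1)).Connected :=
      { preconnected := (isPreconnectedOn_iff _ _).1 (hB.preconnected x.1 x.2)
        nonempty := (hB.nontrivial x.1 x.2).nonempty.to_subtype }
    exact hconn.exists_isTree_le
  choose t ht htree using htree
  have htG : ∀ x, t x ≤ G.induce (B x.1) := fun x u v huv => (ht x huv).1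
  have hadj : ∀ x y, (U h d).Adj x y → ∃ u ∈ B x.1, ∃ v ∈ B y.1, G.Adj u v ∧ c u = c v := by
    intro x y hxy
    obtain ⟨hne, hs | hs⟩ := (U_adj x y).1 hxy
    · obtain ⟨u, hu, v, hv, huv, hc⟩ := hB.adj y.1 x.1 y.2 x.2
        (fun h => hne (Subtype.ext h.symm)) hs
      exact ⟨v, hv, u, hu, huv.symm, hc.symm⟩
    · exact hB.adj x.1 y.1 x.2 y.2 (fun h => hne (Subtype.ext h)) hs
  let M : Model (U h d) G :=
    { T := fun x => subgraphOf (t x) (htG x)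
      isTree := fun x => by
        rw [subgraphOf_coe]
        exact htree x
      disjoint := fun x y hxy => hB.disjoint x.1 y.1 x.2 y.2 fun h => hxy (Subtype.ext h)
      exists_adj := fun x y hxy => by
        obtain ⟨u, hu, v, hv, huv, _⟩ := hadj x y hxy
        exact ⟨u, hu, v, hv, huv⟩ }
  refine ⟨M, fun x => hB.nontrivial x.1 x.2, fun v => c v, ?_, ?_⟩
  · rintro x u v ⟨hu, hv, huv⟩
    exact (ht x huv).2
  · intro x y hxy
    obtain ⟨u, hu, v, hv, huv, hc⟩ := hadj x y hxy
    exact ⟨⟨u, x, hu⟩, ⟨v, y, hv⟩, hu, hv, Or.inr ⟨x, y, hxy, hu, hv, huv⟩, hc⟩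

theorem hasOddModel_zero {G : SimpleGraph V} {d : ℕ} {S : Set V} {u v : V} (hu : u ∈ S)
    (hv : v ∈ S) (huv : G.Adj u v) : HasOddModel G d 0 S := by
  classical
  refine ⟨fun _ => {u, v}, fun x => decide (x = u), ?_, ?_, ?_, ?_, ?_⟩
  · rintro l - x (rfl | rfl)
    · exact hu
    · exact hv
  · exact fun l _ => ⟨u, by simp, v, by simp, huv.ne⟩
  · intro l _
    have hs : ∀ x : V, ∀ H : SimpleGraph V, IsPreconnectedOn H {x} := by
      rintro x H Z ⟨_, rfl, h⟩ -
      simpa using h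
    exact (hs u _).union (hs v _) rfl rfl ⟨huv, by simp [huv.ne']⟩
  · intro l l' hl hl' hne
    simp at hl hl'
    exact absurd (hl.trans hl'.symm) hne
  · intro l l' hl hl' hne
    simp at hl hl'
    exact absurd (hl.trans hl'.symm) hne

/-! ### Distance layers -/

/-- `δ` is the distance to `r` inside `G[S]`; its value 0 outside `S` is junk that no clause
mentions. -/
theorem exists_layering {G : SimpleGraph V} {S : Set V} (hS : IsPreconnectedOn G S) {r : V}
    (hr : r ∈ S) : ∃ δ : V → ℕ, (∀ v ∈ S, δ v = 0 ↔ v = r) ∧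
      (∀ u ∈ S, ∀ v ∈ S, G.Adj u v → δ v ≤ δ u + 1) ∧
      ∀ v ∈ S, ∀ i, δ v = i + 1 → ∃ u ∈ S, δ u = i ∧ G.Adj u v := by
  classical
  have hconn : (G.induce S).Connected :=
    { preconnected := (isPreconnectedOn_iff _ _).1 hS
      nonempty := ⟨⟨r, hr⟩⟩ }
  have hδ : ∀ v (hv : v ∈ S), (if h : v ∈ S then (G.induce S).dist ⟨v, h⟩ ⟨r, hr⟩ else 0) =
      (G.induce S).dist ⟨v, hv⟩ ⟨r, hr⟩ := fun v hv => dif_pos hv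
  refine ⟨fun v => if h : v ∈ S then (G.induce S).dist ⟨v, h⟩ ⟨r, hr⟩ else 0, ?_, ?_, ?_⟩
  · intro v hv
    simp only [hδ v hv]
    rw [hconn.dist_eq_zero_iff]
    simp
  · intro u hu v hv huv
    simp only [hδ v hv, hδ u hu]
    have h1 : (G.induce S).Adj ⟨v, hv⟩ ⟨u, hu⟩ := by simpa using huv.symm
    have h2 := hconn.dist_triangle (u := ⟨v, hv⟩) (v := ⟨u, hu⟩) (w := ⟨r, hr⟩)
    rw [SimpleGraph.dist_eq_one_iff_adj.2 h1] at h2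
    omega
  · intro v hv i hi
    simp only [hδ v hv] at hi
    obtain ⟨p, hp⟩ := hconn.exists_walk_length_eq_dist ⟨v, hv⟩ ⟨r, hr⟩
    rw [hi] at hp
    cases p with
    | nil => simp at hp
    | @cons _ u _ hvu q =>
      refine ⟨u, u.2, ?_, ?_⟩
      · simp only [hδ u u.2]
        have h1 := SimpleGraph.dist_le q
        have h2 := hconn.dist_triangle (u := ⟨v, hv⟩) (v := u) (w := ⟨r, hr⟩)
        rw [SimpleGraph.dist_eq_one_iff_adj.2 hvu] at h2
        simp only [SimpleGraph.Walk.length_cons] at hp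
        simp only [Subtype.coe_eta]
        omega
      · have := hvu.symm
        simpa using this

/-- The layers below a given one are connected by edges between consecutive layers. -/
theorem isPreconnectedOn_lower_layers {G : SimpleGraph V} {S : Set V} {δ : V → ℕ} {r : V}
    (h0 : ∀ v ∈ S, δ v = 0 ↔ v = r)
    (hpar : ∀ v ∈ S, ∀ i, δ v = i + 1 → ∃ u ∈ S, δ u = i ∧ G.Adj u v) (i : ℕ) :
    IsPreconnectedOn (bichromatic G fun v => decide (δ v % 2 = 0)) {v | v ∈ S ∧ δ v < i} := by
  rintro Z ⟨a, ⟨haS, hai⟩, haZ⟩ hZ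
  have hcol : ∀ u v k, δ u = k → δ v = k + 1 →
      decide (δ u % 2 = 0) ≠ decide (δ v % 2 = 0) := by
    intro u v k hu hv h
    rw [decide_eq_decide] at h
    omega
  -- Consecutive layers differ in parity, so parent edges are bichromatic: follow them from a point
  -- of `Z` down to `r`, then back from `r` to every vertex of the lower layers.
  have down : ∀ k, ∀ v ∈ S, δ v = k → k < i → v ∈ Z → r ∈ Z := by
    intro k
    induction k with
    | zero =>
      intro v hv hvk _ hvZ
      rwa [(h0 v hv).1 hvk] at hvZ
    | succ k ih =>
      intro v hv hvk hki hvZ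
      obtain ⟨u, hu, huk, huv⟩ := hpar v hv k hvk
      exact ih u hu huk (by omega) (hZ v ⟨hv, by omega⟩ hvZ u ⟨hu, by omega⟩
        ⟨huv.symm, (hcol u v k huk hvk).symm⟩)
  have hrZ := down _ a haS rfl hai haZ
  have up : ∀ k, ∀ v ∈ S, δ v = k → k < i → v ∈ Z := by
    intro k
    induction k with
    | zero =>
      intro v hv hvk _
      rwa [(h0 v hv).1 hvk]
    | succ k ih =>
      intro v hv hvk hki
      obtain ⟨u, hu, huk, huv⟩ := hpar v hv k hvk
      exact hZ u ⟨hu, by omega⟩ (ih u hu huk (by omega)) v ⟨hv, by omega⟩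
        ⟨huv, hcol u v k huk hvk⟩
  exact fun v hv => up _ v hv.1 rfl hv.2

/-- If `G[S]` does not contain `k + 1` disjoint models, then all models in it can be destroyed by
deleting few vertices. -/
theorem exists_cover_oddModel {G : SimpleGraph V} (D : TreeDecomposition G) {b : ℕ}
    (hD : ∀ x, (D.bag x).card ≤ b) {d n k : ℕ} {S : Set V}
    (hS : ¬ ∃ A : Fin (k + 1) → Set V, (∀ j, A j ⊆ S ∧ HasOddModel G d n (A j)) ∧
      ∀ i j, i ≠ j → Disjoint (A i) (A j)) :
    ∃ X : Finset V, X.card ≤ k * b ∧ ¬ HasOddModel G d n (S \ X) := by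
  rcases exists_disjoint_or_cover D b hD k
      {A | A ⊆ S ∧ A.Nonempty ∧ IsPreconnectedOn G A ∧ HasOddModel G d n A}
      (fun A hA => ⟨hA.2.1, hA.2.2.1⟩) with ⟨A, hA, hdisj⟩ | ⟨X, hX, hcov⟩
  · exact absurd ⟨A, fun j => ⟨(hA j).1, (hA j).2.2.2⟩, hdisj⟩ hS
  · refine ⟨X, hX, fun hm => ?_⟩
    obtain ⟨A, hAS, hne, hconn, hA⟩ := hm.exists_connected
    obtain ⟨v, hv, hvX⟩ := hcov A ⟨hAS.trans Set.sdiff_subset, hne, hconn, hA⟩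
    exact (hAS hv).2 hvX

/-- For `i ≥ 2` the lower layers are the root set of a join, and `k * b` vertices suffice. The
additional vertex pays for the two first layers, where the lower layers are empty or the single
vertex `r` and thus no non-trivial branch set. -/
theorem exists_cover_layer {G : SimpleGraph V} (D : TreeDecomposition G) {b : ℕ}
    (hD : ∀ x, (D.bag x).card ≤ b) {n k : ℕ} {S : Set V} {δ : V → ℕ} {r : V}
    (hr : r ∈ S) (h0 : ∀ v ∈ S, δ v = 0 ↔ v = r)
    (hpar : ∀ v ∈ S, ∀ i, δ v = i + 1 → ∃ u ∈ S, δ u = i ∧ G.Adj u v)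
    (hS : ¬ HasOddModel G (k + 1) (n + 1) S) (i : ℕ) :
    ∃ X : Finset V, X.card ≤ k * b + 1 ∧
      ¬ HasOddModel G (k + 1) n ({v | v ∈ S ∧ δ v = i} \ X) := by
  classical
  rcases Nat.eq_zero_or_pos i with rfl | hi
  · refine ⟨{r}, by simp, fun hm => ?_⟩
    obtain ⟨v, ⟨hv, hv0⟩, hvr⟩ := hm.nonempty
    exact hvr (by simpa using (h0 v hv).1 hv0)
  by_cases hemp : ∃ v ∈ S, δ v = i
  swap
  · refine ⟨∅, by simp, fun hm => ?_⟩
    obtain ⟨v, ⟨hv, hv0⟩, -⟩ := hm.nonempty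
    exact hemp ⟨v, hv, hv0⟩
  obtain ⟨v₁, hv₁, hv₁i⟩ := hemp
  by_cases hi1 : i = 1
  · subst hi1
    have hrv : ∀ v ∈ S, δ v = 1 → G.Adj r v := by
      intro v hv hv1
      obtain ⟨u, hu, hu0, huv⟩ := hpar v hv 0 hv1
      rwa [← (h0 u hu).1 hu0]
    -- Sacrifice one vertex `v₁` of layer 1, so that `{r, v₁}` is a non-trivial root set. With only
    -- `r` coloured `true`, its edge is bichromatic and every other vertex of the layer sees `r`.
    obtain ⟨X, hX, hXm⟩ := exists_cover_oddModel D hD (d := k + 1) (n := n) (k := k)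
      (S := {v | v ∈ S ∧ δ v = 1} \ {v₁}) (by
        rintro ⟨A, hA, hdisj⟩
        refine hS (HasOddModel.join (R := {r, v₁}) (c₀ := fun v => decide (v = r)) (A := A)
          ⟨r, by simp, v₁, by simp, (hrv v₁ hv₁ hv₁i).ne⟩ ?_ ?_ ?_ (fun j => (hA j).2) hdisj
          ?_ true ?_)
        · rintro Z ⟨a, ha, haZ⟩ hZ
          have h1 := (hrv v₁ hv₁ hv₁i)
          have h2 := hZ r (by simp)
          have h3 := hZ v₁ (by simp)
          have h4 : r ∈ Z ↔ v₁ ∈ Z :=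
            ⟨fun h => h2 h v₁ (by simp) ⟨h1, by simp [h1.ne']⟩,
              fun h => h3 h r (by simp) ⟨h1.symm, by simp [h1.ne']⟩⟩
          rcases ha with rfl | rfl
          · rintro x (rfl | rfl)
            exacts [haZ, h4.1 haZ]
          · rintro x (rfl | rfl)
            exacts [h4.2 haZ, haZ]
        · rintro x (rfl | rfl)
          exacts [hr, hv₁]
        · exact fun j v hv => ((hA j).1 hv).1.1
        · intro j
          rw [Set.disjoint_left]
          rintro x (rfl | rfl) hx
          · have h1 := ((hA j).1 hx).1.2
            have h2 := (h0 x hr).2 rfl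
            omega
          · exact ((hA j).1 hx).2 rfl
        · intro j v hv
          exact ⟨r, by simp, hrv v ((hA j).1 hv).1.1 ((hA j).1 hv).1.2, by simp⟩)
    refine ⟨insert v₁ X, (Finset.card_insert_le _ _).trans (by omega), fun hm => hXm ?_⟩
    refine hm.mono ?_
    rintro v ⟨hv, hvX⟩
    simp only [Finset.coe_insert, Set.mem_insert_iff, not_or] at hvX
    exact ⟨⟨hv, hvX.1⟩, hvX.2⟩
  · obtain ⟨X, hX, hXm⟩ := exists_cover_oddModel D hD (d := k + 1) (n := n) (k := k)
      (S := {v | v ∈ S ∧ δ v = i}) (by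
        rintro ⟨A, hA, hdisj⟩
        refine hS (HasOddModel.join (R := {v | v ∈ S ∧ δ v < i})
          (c₀ := fun v => decide (δ v % 2 = 0)) (A := A) ?_
          (isPreconnectedOn_lower_layers h0 hpar i) (fun v hv => hv.1)
          (fun j v hv => ((hA j).1 hv).1) (fun j => (hA j).2) hdisj ?_
          (decide ((i - 1) % 2 = 0)) ?_)
        · obtain ⟨u, hu, hui, -⟩ := hpar v₁ hv₁ (i - 1) (by omega)
          have hr0 := (h0 r hr).2 rfl
          refine ⟨r, ⟨hr, by omega⟩, u, ⟨hu, by omega⟩, ?_⟩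
          rintro rfl
          omega
        · intro j
          rw [Set.disjoint_left]
          rintro x ⟨-, hx⟩ hxA
          exact hx.ne ((hA j).1 hxA).2
        · intro j v hv
          obtain ⟨hvS, hvi⟩ := (hA j).1 hv
          obtain ⟨u, hu, hui, huv⟩ := hpar v hvS (i - 1) (by omega)
          exact ⟨u, ⟨hu, by omega⟩, huv, by rw [hui]⟩)
    exact ⟨X, by omega, hXm⟩

/-! ### Clustered colourings of vertex sets -/

/-- Every monochromatic connected subset of `S` has at most `m` vertices. -/
def ClusteredOn {α : Type*} (G : SimpleGraph V) (S : Set V) (c : V → α) (m : ℕ) : Prop :=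
  ∀ A ⊆ S, IsPreconnectedOn G A → (∀ u ∈ A, ∀ v ∈ A, c u = c v) → A.ncard ≤ m

/-- Clustered colourings of the connected subsets of `S` yield one of `S`. -/
theorem exists_clusteredOn_of_connected {α : Type*} {G : SimpleGraph V} {S : Set V} {m : ℕ}
    (hα : Nonempty α)
    (h : ∀ K ⊆ S, K.Nonempty → IsPreconnectedOn G K → ∃ c : V → α, ClusteredOn G K c m) :
    ∃ c : V → α, ClusteredOn G S c m := by
  classical
  let K : (G.induce S).ConnectedComponent → Set V := fun C => Subtype.val '' C.supp
  have hKS : ∀ C, K C ⊆ S := by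
    rintro C _ ⟨x, -, rfl⟩
    exact x.2
  have hK : ∀ C, ∃ c : V → α, ClusteredOn G (K C) c m := by
    intro C
    obtain ⟨x, hx⟩ := C.nonempty_supp
    exact h _ (hKS _) ⟨x, x, hx, rfl⟩ (isPreconnectedOn_supp _)
  choose c hc using hK
  refine ⟨fun v => if hv : v ∈ S then c ((G.induce S).connectedComponentMk ⟨v, hv⟩) v
    else hα.some, ?_⟩
  intro A hAS hA hmono
  rcases A.eq_empty_or_nonempty with rfl | ⟨a, ha⟩
  · simp
  have hAK : A ⊆ K ((G.induce S).connectedComponentMk ⟨a, hAS ha⟩) := by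
    refine hA _ ⟨a, ha, ⟨a, hAS ha⟩, rfl, rfl⟩ ?_
    rintro _ hu ⟨u, hu', rfl⟩ v hv huv
    refine ⟨⟨v, hAS hv⟩, ?_, rfl⟩
    rw [SimpleGraph.ConnectedComponent.mem_supp_iff] at hu' ⊢
    rw [← hu']
    refine SimpleGraph.ConnectedComponent.sound (SimpleGraph.Adj.reachable ?_)
    simpa using huv.symm
  have hcol : ∀ v ∈ A, (if hv : v ∈ S then c ((G.induce S).connectedComponentMk ⟨v, hv⟩) v
      else hα.some) = c ((G.induce S).connectedComponentMk ⟨a, hAS ha⟩) v := by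
    intro v hv
    obtain ⟨x, hx, rfl⟩ := hAK hv
    rw [SimpleGraph.ConnectedComponent.mem_supp_iff] at hx
    rw [dif_pos x.2, ← hx]
  refine hc _ A hAK hA fun u hu v hv => ?_
  rw [← hcol u hu, ← hcol v hv]
  exact hmono u hu v hv

/-- Give the vertices of a small set `X` a new colour. -/
theorem ClusteredOn.extend {G : SimpleGraph V} {S : Set V} {N m : ℕ} {X : Finset V}
    {c : V → Fin N} (h : ClusteredOn G (S \ X) c m) (hX : X.card ≤ m) :
    ∃ c' : V → Fin (N + 1), ClusteredOn G S c' m := by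
  classical
  refine ⟨fun v => if v ∈ X then Fin.last N else (c v).castSucc, fun A hAS hA hmono => ?_⟩
  by_cases hAX : ∃ a ∈ A, a ∈ X
  · obtain ⟨a, ha, haX⟩ := hAX
    have : A ⊆ X := by
      intro v hv
      by_contra hvX
      have h1 := hmono v hv a ha
      simp only [if_pos haX, if_neg (show v ∉ X from hvX)] at h1
      exact (Fin.castSucc_lt_last (c v)).ne h1
    exact (Set.ncard_le_ncard this X.finite_toSet).trans (by rwa [Set.ncard_coe_finset])
  · push Not at hAX
    refine h A (fun v hv => ⟨hAS hv, hAX v hv⟩) hA fun u hu v hv => ?_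
    have h1 := hmono u hu v hv
    simp only [if_neg (hAX u hu), if_neg (hAX v hv)] at h1
    exact Fin.castSucc_injective _ h1

/-- Combine colourings of the layers, with two alternating palettes. -/
theorem exists_clusteredOn_of_layers {G : SimpleGraph V} {S : Set V} {N m : ℕ} {δ : V → ℕ}
    (hδ : ∀ u ∈ S, ∀ v ∈ S, G.Adj u v → δ v ≤ δ u + 1)
    (h : ∀ i, ∃ c : V → Fin N, ClusteredOn G {v | v ∈ S ∧ δ v = i} c m) :
    ∃ c : V → Fin (2 * N), ClusteredOn G S c m := by
  choose c hc using h
  refine ⟨fun v => finProdFinEquiv (⟨δ v % 2, Nat.mod_lt _ two_pos⟩, c (δ v) v), ?_⟩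
  intro A hAS hA hmono
  rcases A.eq_empty_or_nonempty with rfl | ⟨a, ha⟩
  · simp
  have hmono' : ∀ u ∈ A, ∀ v ∈ A, δ u % 2 = δ v % 2 ∧ c (δ u) u = c (δ v) v := by
    intro u hu v hv
    have := finProdFinEquiv.injective (hmono u hu v hv)
    simpa using this
  -- An edge changes the depth by at most one, and equal palettes mean equal parity, so the depth is
  -- constant on `A`.
  have hAa : A ⊆ {v | δ v = δ a} := by
    refine hA _ ⟨a, ha, rfl⟩ ?_
    intro u hu hua v hv huv
    have h1 := hδ u (hAS hu) v (hAS hv) huv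
    have h2 := hδ v (hAS hv) u (hAS hu) huv.symm
    have h3 := (hmono' u hu v hv).1
    simp only [Set.mem_ofPred_eq] at hua ⊢
    omega
  refine hc (δ a) A (fun v hv => ⟨hAS hv, hAa hv⟩) hA fun u hu v hv => ?_
  have h1 := (hmono' u hu v hv).2
  rwa [show δ u = δ a from hAa hu, show δ v = δ a from hAa hv] at h1

theorem exists_clusteredOn {G : SimpleGraph V} (D : TreeDecomposition G) {b : ℕ}
    (hD : ∀ x, (D.bag x).card ≤ b) (k n : ℕ) (S : Set V) (hS : ¬ HasOddModel G (k + 1) n S) :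
    ∃ c : V → Fin (3 * 2 ^ n - 2), ClusteredOn G S c (k * b + 1) := by
  induction n generalizing S with
  | zero =>
    refine ⟨fun _ => ⟨0, by norm_num⟩, fun A hAS hA _ => ?_⟩
    rcases A.eq_empty_or_nonempty with rfl | ⟨a, ha⟩
    · simp
    have hAa : A ⊆ {a} := by
      refine hA _ ⟨a, ha, rfl⟩ ?_
      rintro u hu - v hv huv
      exact absurd (hasOddModel_zero (hAS hu) (hAS hv) huv) hS
    exact (Set.ncard_le_ncard hAa).trans (by simp)
  | succ n ih =>
    have hpos : 0 < 2 ^ n := by positivity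
    have hN : 3 * 2 ^ (n + 1) - 2 = 2 * (3 * 2 ^ n - 2 + 1) := by
      rw [pow_succ]
      omega
    rw [hN]
    -- A layering by distance from one root needs a connected set.
    refine exists_clusteredOn_of_connected ⟨⟨0, by omega⟩⟩ ?_
    rintro K hKS ⟨r, hr⟩ hK
    obtain ⟨δ, h0, hδ, hpar⟩ := exists_layering hK hr
    refine exists_clusteredOn_of_layers hδ fun i => ?_
    obtain ⟨X, hX, hXm⟩ := exists_cover_layer D hD hr h0 hpar (fun h => hS (h.mono hKS)) i
    obtain ⟨c, hc⟩ := ih _ hXm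
    exact hc.extend hX

theorem ClusteredOn.hasClustering {α : Type*} {G : SimpleGraph V} {c : V → α} {m : ℕ}
    (h : ClusteredOn G Set.univ c m) : HasClustering G c m := by
  intro i C
  have hcard : (Subtype.val '' C.supp).ncard = C.supp.ncard :=
    Set.ncard_image_of_injective _ Subtype.val_injective
  rw [← hcard]
  refine h _ (Set.subset_univ _) (isPreconnectedOn_supp C) ?_
  rintro _ ⟨u, -, rfl⟩ _ ⟨v, -, rfl⟩
  exact u.2.trans v.2.symm

end OddMinor

theorem lemma4 (d h w : ℕ) (hd : 1 ≤ d) (hh : 1 ≤ h) (hw : 1 ≤ w)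
    {V : Type*} [Fintype V] (G : SimpleGraph V)
    (htw : OddMinor.treewidth G ≤ (w : ℤ))
    (hG : ¬ ∃ M : OddMinor.Model (OddMinor.U h d) G, M.IsNontrivial ∧ M.IsOdd) :
    ∃ c : V → Fin (3 * 2 ^ (h - 1) - 2), OddMinor.HasClustering G c (d * w + d - w) := by
  obtain ⟨D, hD⟩ := OddMinor.exists_width_eq_treewidth G
  have hbag : ∀ x, (D.bag x).card ≤ w + 1 := by
    intro x
    have h1 : (D.bag x).card ≤ Finset.univ.sup fun x => (D.bag x).card :=
      Finset.le_sup (f := fun x => (D.bag x).card) (Finset.mem_univ x)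
    rw [← hD, OddMinor.TreeDecomposition.width] at htw
    omega
  obtain ⟨k, rfl⟩ : ∃ k, d = k + 1 := ⟨d - 1, by omega⟩
  obtain ⟨c, hc⟩ := OddMinor.exists_clusteredOn D hbag k (h - 1) Set.univ
    fun hm => hG hm.exists_model
  -- With d = k + 1 and bags of at most w + 1 vertices, the cover size k (w + 1) + 1 is exactly the
  -- required clustering.
  have hm : (k + 1) * w + (k + 1) - w = k * (w + 1) + 1 := by
    rw [Nat.succ_mul, Nat.mul_succ]
    omega
  exact ⟨c, hm ▸ hc.hasClustering⟩
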